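/- Let $\mathbb T=\mathbb R/2\pi\mathbb Z$, $\hat f(k)=\frac1{2\pi}\int_{\mathbb T}f(\xi)e^{-ik\xi}\,d\xi$ and $\|f\|_{H^s}^2=\sum_{k\in\mathbb Z}(1+k^2)^s|\hat f(k)|^2$. Let $\Lambda$ and $\mathcal H$ be the Fourier multipliers with symbols $|k|$ and $-i\,\mathrm{sgn}(k)$, put $[\Lambda,f]g=\Lambda(fg)-f\Lambda g$, and for $\Upsilon,\delta>0$ let $a$ and $b$ be the Fourier multipliers with symbols $$a_k=\frac{2(1+\Upsilon|k|)}{4(1+\Upsilon|k|)^2+\delta^2|k|^2k^2},\qquad b_k=\frac{\delta|k|^2}{4(1+\Upsilon|k|)^2+\delta^2|k|^2k^2}\qquad(k\in\mathbb Z).$$ For $\varepsilon,\Upsilon,\delta,\beta>0$ consider the equation $$F_\tau=\frac1\varepsilon(a+b\mathcal H)\Big((I+\Upsilon\Lambda)F_\xi+\frac\beta4\Lambda F_{\xi\xi\xi}+\delta\Lambda F_{\xi\xi}+\mathcal HF\Big)-(a+b\mathcal H)\Big(2F_\xi\,\Lambda F-[\Lambda,F]F_\xi\Big).\qquad(*)$$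 By a solution on $[0,T]$ with datum $F_0$ we mean $F\in C([0,T];H^2(\mathbb T))$ with $F(\cdot,0)=F_0$ such that at each $\tau\in[0,T]$ the derivative $F_\tau$ exists in $L^2(\mathbb T)$ (one-sided at the end points) and $(*)$ holds in $L^2(\mathbb T)$. **Theorem 6.1.** Let $\varepsilon,\Upsilon,\delta,\beta>0$ and let $F_0\in H^2(\mathbb T)$, of any size, have zero mean. Then there is a time $T>0$, depending only on $\|F_0\|_{H^2}$ and the parameters $\varepsilon,\Upsilon,\delta,\beta$, such that $(*)$ has a unique solution $F\in C([0,T];H^2(\mathbb T))$ on $[0,T]$ with $F(\cdot,0)=F_0$. Functions may be complex valued; if $F_0$ is real valued, then so is $F(\cdot,\tau)$ for every $\tau\in[0,T]$. -/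

import Mathlib

open MeasureTheory Set Filter Topology

noncomputable section

namespace Plate

/-- The interval length of the torus is positive. -/
instance factTwoPiPos : Fact (0 < 2 * Real.pi) := ⟨Real.two_pi_pos⟩

/-- The one-dimensional torus `𝕋 = ℝ / 2πℤ`. -/
abbrev Torus : Type := AddCircle (2 * Real.pi)

/-- Complex `L²(𝕋)`, for the normalized measure `dξ / 2π`. -/
abbrev L2T : Type := Lp ℂ 2 (AddCircle.haarAddCircle : Measure Torus)

/-- A periodic distribution `u = ∑ u k e^{ikξ}` on `𝕋`, given by its Fourier coefficients.
It is needed because third and fourth derivatives of `H²` functions are not functions. -/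
abbrev PerDist : Type := ℤ → ℂ

/-- The Fourier coefficients `f̂(k) = (1/2π) ∫ f(ξ) e^{-ikξ} dξ` of `f ∈ L²(𝕋)`, that is, `f`
seen as a periodic distribution. -/
def coef (f : L2T) : PerDist := fun k => fourierCoeff (f : Torus → ℂ) k

open Classical in
/-- The function in `L²(𝕋)` with the given square-summable Fourier coefficients
(and `0` if they are not square summable). -/
def toL2 (u : PerDist) : L2T :=
  if h : Memℓp u 2 then (fourierBasis (T := 2 * Real.pi)).repr.symm ⟨u, h⟩ else 0

/-- The mean `⟨f⟩ = (1/2π) ∫ f`. -/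
def mean (f : L2T) : ℂ := ∫ x, f x ∂(AddCircle.haarAddCircle : Measure Torus)

/-- `f` is real valued (almost everywhere). -/
def IsRealValued (f : L2T) : Prop :=
  ∀ᵐ x ∂(AddCircle.haarAddCircle : Measure Torus), (f x).im = 0

/-- `f ∈ H^s(𝕋)` (used for `s ≥ 0`). -/
def MemSobolev (s : ℝ) (f : L2T) : Prop :=
  Summable fun k : ℤ => (1 + (k : ℝ) ^ 2) ^ s * ‖coef f k‖ ^ 2

/-- The norm `‖f‖_{H^s} = (∑ (1 + k²)^s |f̂(k)|²)^{1/2}`. -/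
def sobolevNorm (s : ℝ) (f : L2T) : ℝ :=
  Real.sqrt (∑' k : ℤ, (1 + (k : ℝ) ^ 2) ^ s * ‖coef f k‖ ^ 2)

/-- `F ∈ C([0,T]; H^s(𝕋))`. -/
def ContinuousInSobolev (s T : ℝ) (F : ℝ → L2T) : Prop :=
  (∀ τ ∈ Icc 0 T, MemSobolev s (F τ)) ∧
  ∀ τ ∈ Icc 0 T,
    Tendsto (fun σ => sobolevNorm s (F σ - F τ)) (𝓝[Icc 0 T] τ) (𝓝 0)

/-- The Fourier multiplier with symbol `m`. -/
def mult (m : ℤ → ℂ) (u : PerDist) : PerDist := fun k => m k * u k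

/-- The derivative `∂_ξ`. -/
def dxi : PerDist → PerDist := mult fun k => Complex.I * k

/-- The operator `Λ = |D_ξ|`. -/
def Lam : PerDist → PerDist := mult fun k => ((|(k : ℝ)| : ℝ) : ℂ)

/-- The Hilbert transform `ℋ`, with symbol `-i sgn k`. -/
def Hilb : PerDist → PerDist := mult fun k => -Complex.I * (Int.sign k : ℂ)

/-- The denominator `4(1 + Υ|k|)² + δ²|k|²k²`. -/
def den (Υ δ : ℝ) (k : ℤ) : ℝ :=
  4 * (1 + Υ * |(k : ℝ)|) ^ 2 + δ ^ 2 * |(k : ℝ)| ^ 2 * (k : ℝ) ^ 2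

/-- The multiplier `a`, with symbol `2(1 + Υ|k|) / (4(1 + Υ|k|)² + δ²|k|²k²)`. -/
def aOp (Υ δ : ℝ) : PerDist → PerDist :=
  mult fun k => ((2 * (1 + Υ * |(k : ℝ)|) / den Υ δ k : ℝ) : ℂ)

/-- The multiplier `b`, with symbol `δ|k|² / (4(1 + Υ|k|)² + δ²|k|²k²)`. -/
def bOp (Υ δ : ℝ) : PerDist → PerDist :=
  mult fun k => ((δ * |(k : ℝ)| ^ 2 / den Υ δ k : ℝ) : ℂ)

/-- The operator `a + bℋ`. -/
def abH (Υ δ : ℝ) (u : PerDist) : PerDist := aOp Υ δ u + bOp Υ δ (Hilb u)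

/-- The pointwise product of two distributions that are functions in `L²(𝕋)`; the product is an
integrable function, and is returned as a distribution. -/
def prodD (u v : PerDist) : PerDist :=
  fun k => fourierCoeff (fun x : Torus => toL2 u x * toL2 v x) k

/-- The commutator `⟦A, f⟧ g = A(fg) - f (Ag)`. -/
def comm (A : PerDist → PerDist) (f g : PerDist) : PerDist := A (prodD f g) - prodD f (A g)

/-- The linear expression
`(I + ΥΛ)F_ξ + (β/4) Λ F_ξξξ + δ Λ F_ξξ + ℋF`. -/
def linPart (Υ δ β : ℝ) (u : PerDist) : PerDist :=
  (dxi u + (Υ : ℂ) • Lam (dxi u)) + ((β / 4 : ℝ) : ℂ) • Lam (dxi (dxi (dxi u)))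
    + (δ : ℂ) • Lam (dxi (dxi u)) + Hilb u

/-- The quadratic expression `2 F_ξ ΛF - ⟦Λ, F⟧ F_ξ`. -/
def quadPart (u : PerDist) : PerDist :=
  (2 : ℂ) • prodD (dxi u) (Lam u) - comm Lam u (dxi u)

/-- The right-hand side of the first unidirectional model,
`ε⁻¹ (a + bℋ)((I + ΥΛ)F_ξ + (β/4) Λ F_ξξξ + δ Λ F_ξξ + ℋF) - (a + bℋ)(2 F_ξ ΛF - ⟦Λ, F⟧ F_ξ)`. -/
def modelRHS (ε Υ δ β : ℝ) (u : PerDist) : PerDist :=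
  ((1 / ε : ℝ) : ℂ) • abH Υ δ (linPart Υ δ β u) - abH Υ δ (quadPart u)

/-- `F ∈ C([0,T]; H²(𝕋))` solves the Cauchy problem for the first unidirectional model on `[0,T]`
with `F(0) = F₀`. For such `F` the right-hand side of the equation is in `L²(𝕋)` at all times; the
time derivative exists in `L²(𝕋)` at each time (one-sided at the end points of `[0,T]`) and the
equation is an equality of elements of `L²(𝕋)`. -/
structure IsSolution (ε Υ δ β T : ℝ) (F₀ : L2T) (F : ℝ → L2T) : Prop where
  continuous : ContinuousInSobolev 2 T F
  initial : F 0 = F₀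
  equation : ∀ τ ∈ Icc 0 T, ∃ V : L2T,
    coef V = modelRHS ε Υ δ β (coef (F τ)) ∧ HasDerivWithinAt F V (Icc 0 T) τ

end Plate

end

/-!
On the Fourier side the equation reads `uₖ' = λₖ uₖ + N(u)ₖ`, where `u` is the sequence of Fourier
coefficients of `F`. The symbol of `a + bℋ` has modulus `(4(1 + Υ|k|)² + δ²k⁴)^{-1/2}`, so this
operator gains two derivatives. Two facts follow.

* The linear part `λ` is of order two, although `Λ ∂_ξ³` is of order four, and `Re λₖ` is bounded
  above (`re_symModel_le`): the surface tension term meets the multiplier `bℋ` and becomes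
  dissipative. Hence `e^{tL}`, with entries `e^{tλₖ}`, is a strongly continuous semigroup on `H²`.
* The quadratic expression `2 F_ξ ΛF - ⟦Λ, F⟧ F_ξ` loses two derivatives, and is bounded from `H²` to
  `L²` because every product in it has a factor whose Fourier coefficients are summable. After
  `a + bℋ` is applied, `N` is a bounded quadratic map of `H²` into itself (`quadForm`,
  `modelRHS_unweight`).

The equation is therefore a Lipschitz perturbation of a linear semigroup, and no smoothing is
needed. Everything is carried out in `ℓ²(ℤ)`, which the weight `1 + k²` identifies with `H²(𝕋)`
(`ofWeighted`). Local existence is the contraction principle for Duhamel's formula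
(`exists_isModeSolution`); the time depends only on the norm of the datum. Uniqueness, among all
continuous curves and not only in the ball of the contraction, is Grönwall's inequality
(`IsModeSolution.eqOn`). The link with solutions in the sense of the theorem is that a curve which
solves the equation mode by mode is given by Duhamel's formula (`eq_duhamel`), and that a curve whose
modes have derivatives forming a continuous curve in `ℓ²(ℤ)` is differentiable
(`hasDerivWithinAt_of_coord`); the latter is applied to the unweighted coefficients, since the right
side of the equation is continuous in `L²` and not in `H²`. Finally all symbols satisfy
`s(-k) = conj (s k)`, so complex conjugation maps solutions to solutions, and uniqueness shows that
real data have real solutions.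
-/

noncomputable section

namespace Plate

open scoped ComplexConjugate

/-- The space `ℓ²(ℤ)` of square-summable complex sequences. -/
abbrev SqSum : Type := lp (fun _ : ℤ => ℂ) 2

/-! ### Diagonal operators on `ℓ²(ℤ)` -/

theorem memℓp_two_iff {u : ℤ → ℂ} : Memℓp u 2 ↔ Summable fun k => ‖u k‖ ^ 2 := by
  rw [memℓp_gen_iff (by norm_num)]
  simp

theorem SqSum.hasSum_sq (w : SqSum) : HasSum (fun k => ‖w k‖ ^ 2) (‖w‖ ^ 2) := by
  simpa using lp.hasSum_norm (p := 2) (by norm_num) w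

theorem SqSum.norm_le_of_coord {w z : SqSum} {C : ℝ} (hC : 0 ≤ C)
    (h : ∀ k, ‖w k‖ ≤ C * ‖z k‖) : ‖w‖ ≤ C * ‖z‖ := by
  refine le_of_sq_le_sq ?_ (by positivity)
  rw [mul_pow]
  refine hasSum_le (fun k => ?_) w.hasSum_sq (z.hasSum_sq.mul_left (C ^ 2))
  rw [← mul_pow]
  exact pow_le_pow_left₀ (norm_nonneg _) (h k) 2

theorem memℓp_bounded_mul {ρ : ℤ → ℂ} {C : ℝ} (hρ : ∀ k, ‖ρ k‖ ≤ C) (w : SqSum) :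
    Memℓp (fun k => ρ k * w k) 2 := by
  rw [memℓp_two_iff]
  refine Summable.of_nonneg_of_le (fun k => by positivity) (fun k => ?_)
    (w.hasSum_sq.summable.mul_left (C ^ 2))
  rw [norm_mul, mul_pow]
  gcongr
  exact hρ k

open Classical in
/-- The diagonal operator on `ℓ²(ℤ)` with entries `ρ`, where `ρ` is bounded; the value for an
unbounded `ρ` is `0`. -/
def diag (ρ : ℤ → ℂ) : SqSum →L[ℂ] SqSum :=
  if h : ∃ C : ℝ, ∀ k, ‖ρ k‖ ≤ C then
    LinearMap.mkContinuous
      { toFun := fun w => ⟨fun k => ρ k * w k, memℓp_bounded_mul h.choose_spec w⟩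
        map_add' := fun w z => by ext k; simp [mul_add]; rfl
        map_smul' := fun c w => by ext k; simp [mul_left_comm] }
      h.choose
      (fun w => SqSum.norm_le_of_coord ((norm_nonneg _).trans (h.choose_spec 0)) fun k => by
        simp only [LinearMap.coe_mk, AddHom.coe_mk, norm_mul]
        gcongr
        exact h.choose_spec k)
  else 0

theorem diag_apply {ρ : ℤ → ℂ} {C : ℝ} (hρ : ∀ k, ‖ρ k‖ ≤ C) (w : SqSum) (k : ℤ) :
    diag ρ w k = ρ k * w k := by
  have h : ∃ C : ℝ, ∀ k, ‖ρ k‖ ≤ C := ⟨C, hρ⟩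
  simp [diag, dif_pos h]

theorem norm_diag_le {ρ : ℤ → ℂ} {C : ℝ} (hρ : ∀ k, ‖ρ k‖ ≤ C) (w : SqSum) :
    ‖diag ρ w‖ ≤ C * ‖w‖ :=
  SqSum.norm_le_of_coord ((norm_nonneg _).trans (hρ 0)) fun k => by
    rw [diag_apply hρ, norm_mul]
    gcongr
    exact hρ k

/-- Uniformly bounded diagonal operators converge strongly as soon as their entries converge. -/
theorem tendsto_diag {ι : Type*} {l : Filter ι} {ρ : ι → ℤ → ℂ} {σ : ℤ → ℂ} {C : ℝ}
    (hρ : ∀ᶠ i in l, ∀ k, ‖ρ i k‖ ≤ C) (hσ : ∀ k, ‖σ k‖ ≤ C)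
    (h : ∀ k, Tendsto (fun i => ρ i k) l (𝓝 (σ k))) (w : SqSum) :
    Tendsto (fun i => diag (ρ i) w) l (𝓝 (diag σ w)) := by
  rw [tendsto_iff_norm_sub_tendsto_zero]
  suffices H : Tendsto (fun i => ‖diag (ρ i) w - diag σ w‖ ^ 2) l (𝓝 0) by
    have := H.sqrt
    simpa [Real.sqrt_sq] using this
  have key : Tendsto (fun i => ∑' k, ‖(ρ i k - σ k) * w k‖ ^ 2) l
      (𝓝 (∑' k, ‖(σ k - σ k) * w k‖ ^ 2)) := by
    refine tendsto_tsum_of_dominated_convergence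
      (bound := fun k => (2 * C) ^ 2 * ‖w k‖ ^ 2) (w.hasSum_sq.summable.mul_left _) ?_ ?_
    · intro k
      exact ((((h k).sub_const _).mul_const _).norm).pow 2
    · filter_upwards [hρ] with i hi k
      rw [norm_mul, mul_pow, norm_mul, norm_pow, norm_pow, norm_norm, norm_norm]
      gcongr
      calc ‖ρ i k - σ k‖ ≤ ‖ρ i k‖ + ‖σ k‖ := norm_sub_le _ _
        _ ≤ 2 * C := by linarith [hi k, hσ k]
  simp only [sub_self, zero_mul, norm_zero, ne_eq, OfNat.ofNat_ne_zero, not_false_eq_true,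
    zero_pow, tsum_zero] at key
  refine key.congr' ?_
  filter_upwards [hρ] with i hi
  rw [← (SqSum.hasSum_sq _).tsum_eq]
  refine tsum_congr fun k => ?_
  rw [lp.coeFn_sub, Pi.sub_apply, diag_apply hi, diag_apply hσ, sub_mul]

/-! ### Convolution of weighted sequences -/

theorem memℓp_shift (j : ℤ) (w : SqSum) : Memℓp (fun k => w (k - j)) 2 := by
  rw [memℓp_two_iff]
  exact w.hasSum_sq.summable.comp_injective (Equiv.subRight j).injective

/-- The translation `(w k)ₖ ↦ (w (k - j))ₖ` of `ℓ²(ℤ)`. -/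
def shift (j : ℤ) : SqSum →L[ℂ] SqSum :=
  LinearMap.mkContinuous
    { toFun := fun w => ⟨fun k => w (k - j), memℓp_shift j w⟩
      map_add' := fun w z => by ext k; simp; rfl
      map_smul' := fun c w => by ext k; simp }
    1
    (fun w => by
      rw [one_mul]
      refine le_of_sq_le_sq (le_of_eq ?_) (norm_nonneg _)
      exact (SqSum.hasSum_sq _).unique
        ((Equiv.subRight j).hasSum_iff (f := fun k => ‖w k‖ ^ 2) |>.mpr w.hasSum_sq))

theorem norm_shift_le (j : ℤ) (w : SqSum) : ‖shift j w‖ ≤ ‖w‖ :=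
  (LinearMap.mkContinuous_norm_le _ zero_le_one _ |> (shift j).le_of_opNorm_le <| w).trans
    (one_mul _).le

theorem holderConjugate_two_two :
    (2 : ENNReal).toReal.HolderConjugate (2 : ENNReal).toReal := by
  simpa using Real.HolderConjugate.two_two

theorem summable_conv_term (σ w z : SqSum) :
    Summable fun j : ℤ => ‖(σ j * w j) • shift j z‖ := by
  refine Summable.of_nonneg_of_le (fun j => norm_nonneg _) (fun j => ?_)
    ((lp.summable_mul holderConjugate_two_two σ w).mul_right ‖z‖)
  rw [norm_smul, norm_mul]
  gcongr
  exact norm_shift_le j z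

/-- The convolution `(σ w) * z` of `σ w ∈ ℓ¹(ℤ)` and `z ∈ ℓ²(ℤ)`, where `σ, w ∈ ℓ²(ℤ)`, as a
bounded bilinear map of `w` and `z`. -/
def conv (σ : SqSum) : SqSum →L[ℂ] SqSum →L[ℂ] SqSum :=
  LinearMap.mkContinuous₂
    (LinearMap.mk₂ ℂ (fun w z => ∑' j : ℤ, (σ j * w j) • shift j z)
      (fun w w' z => by
        rw [← (summable_conv_term σ w z).of_norm.tsum_add (summable_conv_term σ w' z).of_norm]
        refine tsum_congr fun j => ?_
        rw [lp.coeFn_add, Pi.add_apply, mul_add, add_smul])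
      (fun c w z => by
        rw [← tsum_const_smul'' c]
        refine tsum_congr fun j => ?_
        rw [lp.coeFn_smul, Pi.smul_apply, smul_smul, smul_eq_mul, mul_left_comm])
      (fun w z z' => by
        rw [← (summable_conv_term σ w z).of_norm.tsum_add (summable_conv_term σ w z').of_norm]
        refine tsum_congr fun j => ?_
        rw [map_add, smul_add])
      (fun c w z => by
        rw [← tsum_const_smul'' c]
        refine tsum_congr fun j => ?_
        rw [map_smul, smul_comm]))
    ‖σ‖
    (fun w z => by
      rw [LinearMap.mk₂_apply]
      refine (norm_tsum_le_tsum_norm (summable_conv_term σ w z)).trans ?_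
      have hs := lp.summable_mul holderConjugate_two_two σ w
      calc ∑' j : ℤ, ‖(σ j * w j) • shift j z‖ ≤ ∑' j : ℤ, ‖σ j‖ * ‖w j‖ * ‖z‖ := by
            refine (summable_conv_term σ w z).tsum_le_tsum (fun j => ?_) (hs.mul_right _)
            rw [norm_smul, norm_mul]
            gcongr
            exact norm_shift_le j z
        _ = (∑' j : ℤ, ‖σ j‖ * ‖w j‖) * ‖z‖ := tsum_mul_right
        _ ≤ ‖σ‖ * ‖w‖ * ‖z‖ := by
            gcongr
            exact lp.tsum_mul_le_mul_norm' holderConjugate_two_two σ w)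

theorem hasSum_conv (σ w z : SqSum) (k : ℤ) :
    HasSum (fun j => σ j * w j * z (k - j)) (conv σ w z k) :=
  ((summable_conv_term σ w z).of_norm.hasSum).mapL (lp.evalCLM ℂ (fun _ : ℤ => ℂ) 2 k)

/-! ### The diagonal semigroup and Duhamel's formula -/

/-- The semigroup `e^{tL}` on `ℓ²(ℤ)` generated by the diagonal operator `L` with entries `lam`,
extended to `t < 0` by the identity. -/
def semigroup (lam : ℤ → ℂ) (t : ℝ) : SqSum →L[ℂ] SqSum :=
  diag fun k => Complex.exp (lam k * (max t 0 : ℝ))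

section Semigroup

variable {lam : ℤ → ℂ} {ω : ℝ}

theorem norm_exp_le (hω : 0 ≤ ω) (hlam : ∀ k, (lam k).re ≤ ω) {t T : ℝ} (hT : 0 ≤ T) (htT : t ≤ T)
    (k : ℤ) : ‖Complex.exp (lam k * (max t 0 : ℝ))‖ ≤ Real.exp (ω * T) := by
  rw [Complex.norm_exp, Complex.re_mul_ofReal]
  refine Real.exp_le_exp.mpr ?_
  calc (lam k).re * max t 0 ≤ ω * max t 0 := by gcongr; exact hlam k
    _ ≤ ω * T := by gcongr; exact max_le htT hT

theorem norm_semigroup_le (hω : 0 ≤ ω) (hlam : ∀ k, (lam k).re ≤ ω) {t T : ℝ} (hT : 0 ≤ T)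
    (htT : t ≤ T) (w : SqSum) : ‖semigroup lam t w‖ ≤ Real.exp (ω * T) * ‖w‖ :=
  norm_diag_le (norm_exp_le hω hlam hT htT) w

theorem semigroup_apply (hω : 0 ≤ ω) (hlam : ∀ k, (lam k).re ≤ ω) {t : ℝ} (ht : 0 ≤ t)
    (w : SqSum) (k : ℤ) : semigroup lam t w k = Complex.exp (lam k * t) * w k := by
  rw [semigroup, diag_apply (norm_exp_le hω hlam ht le_rfl), max_eq_left ht]

theorem tendsto_semigroup (hω : 0 ≤ ω) (hlam : ∀ k, (lam k).re ≤ ω) (w : SqSum) (t : ℝ) :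
    Tendsto (fun s => semigroup lam s w) (𝓝 t) (𝓝 (semigroup lam t w)) := by
  refine tendsto_diag (C := Real.exp (ω * (|t| + 1))) ?_ ?_ ?_ w
  · filter_upwards [eventually_le_nhds (show t < |t| + 1 by linarith [le_abs_self t])] with s hs
    exact norm_exp_le hω hlam (by positivity) hs
  · exact norm_exp_le hω hlam (by positivity) (by linarith [le_abs_self t])
  · intro k
    have : Continuous fun s : ℝ => Complex.exp (lam k * (max s 0 : ℝ)) := by fun_prop
    exact this.tendsto t

theorem continuous_semigroup (hω : 0 ≤ ω) (hlam : ∀ k, (lam k).re ≤ ω) :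
    Continuous fun p : ℝ × SqSum => semigroup lam p.1 p.2 := by
  rw [continuous_iff_continuousAt]
  rintro ⟨t, w⟩
  have h1 : Tendsto (fun p : ℝ × SqSum => semigroup lam p.1 (p.2 - w)) (𝓝 (t, w)) (𝓝 0) := by
    rw [tendsto_zero_iff_norm_tendsto_zero]
    have hc : Tendsto (fun p : ℝ × SqSum => Real.exp (ω * max p.1 0) * ‖p.2 - w‖) (𝓝 (t, w))
        (𝓝 0) := by
      have : Continuous fun p : ℝ × SqSum => Real.exp (ω * max p.1 0) * ‖p.2 - w‖ := by fun_prop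
      simpa using this.tendsto (t, w)
    exact squeeze_zero (fun _ => norm_nonneg _)
      (fun p => norm_semigroup_le hω hlam (le_max_right _ _) (le_max_left _ _) _) hc
  have h2 : Tendsto (fun p : ℝ × SqSum => semigroup lam p.1 w) (𝓝 (t, w))
      (𝓝 (semigroup lam t w)) :=
    (tendsto_semigroup hω hlam w t).comp (continuous_fst.tendsto (t, w))
  have h3 := h1.add h2
  rw [zero_add] at h3
  refine h3.congr fun p => ?_
  rw [← map_add, sub_add_cancel]

/-- The mild solution `t ↦ e^{tL} w₀ + ∫₀ᵗ e^{(t-s)L} g(s) ds` of `w' = L w + g`, `w(0) = w₀`. -/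
def duhamel (lam : ℤ → ℂ) (w₀ : SqSum) (g : ℝ → SqSum) (t : ℝ) : SqSum :=
  semigroup lam t w₀ + ∫ s in (0 : ℝ)..t, semigroup lam (t - s) (g s)

theorem continuous_duhamel (hω : 0 ≤ ω) (hlam : ∀ k, (lam k).re ≤ ω) (w₀ : SqSum) {g : ℝ → SqSum}
    (hg : Continuous g) : Continuous (duhamel lam w₀ g) := by
  have hS := continuous_semigroup hω hlam
  refine Continuous.add (hS.comp (by fun_prop : Continuous fun t : ℝ => (t, w₀))) ?_
  refine intervalIntegral.continuous_parametric_intervalIntegral_of_continuous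
    (f := fun t s => semigroup lam (t - s) (g s)) ?_ continuous_id
  exact hS.comp (by fun_prop : Continuous fun p : ℝ × ℝ => (p.1 - p.2, g p.2))

theorem intervalIntegrable_duhamel (hω : 0 ≤ ω) (hlam : ∀ k, (lam k).re ≤ ω) {g : ℝ → SqSum}
    (hg : Continuous g) (t a b : ℝ) :
    IntervalIntegrable (fun s => semigroup lam (t - s) (g s)) volume a b :=
  ((continuous_semigroup hω hlam).comp
    (by fun_prop : Continuous fun s : ℝ => (t - s, g s))).intervalIntegrable a b

theorem continuous_coord {g : ℝ → SqSum} (hg : Continuous g) (k : ℤ) :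
    Continuous fun s => g s k :=
  (lp.evalCLM ℂ (fun _ : ℤ => ℂ) 2 k).continuous.comp hg

theorem intervalIntegral_coord {g : ℝ → SqSum} {a b : ℝ} (hg : IntervalIntegrable g volume a b)
    (k : ℤ) : (∫ s in a..b, g s) k = ∫ s in a..b, g s k :=
  ((lp.evalCLM ℂ (fun _ : ℤ => ℂ) 2 k).intervalIntegral_comp_comm hg).symm

theorem duhamel_apply (hω : 0 ≤ ω) (hlam : ∀ k, (lam k).re ≤ ω) (w₀ : SqSum) {g : ℝ → SqSum}
    (hg : Continuous g) {t : ℝ} (ht : 0 ≤ t) (k : ℤ) :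
    duhamel lam w₀ g t k =
      Complex.exp (lam k * t) * (w₀ k + ∫ s in (0 : ℝ)..t, Complex.exp (-(lam k * s)) * g s k) := by
  rw [duhamel, lp.coeFn_add, Pi.add_apply, semigroup_apply hω hlam ht,
    intervalIntegral_coord (intervalIntegrable_duhamel hω hlam hg t 0 t), mul_add,
    ← intervalIntegral.integral_const_mul]
  congr 1
  refine intervalIntegral.integral_congr fun s hs => ?_
  rw [uIcc_of_le ht] at hs
  simp only
  rw [semigroup_apply hω hlam (sub_nonneg.mpr hs.2), ← mul_assoc, ← Complex.exp_add]
  congr 2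
  push_cast
  ring

theorem hasDerivAt_integral_exp {g : ℝ → SqSum} (hg : Continuous g) (k : ℤ) (t : ℝ) :
    HasDerivAt (fun t : ℝ => ∫ s in (0 : ℝ)..t, Complex.exp (-(lam k * s)) * g s k)
      (Complex.exp (-(lam k * t)) * g t k) t := by
  have hc : Continuous fun s : ℝ => Complex.exp (-(lam k * s)) * g s k := by
    have := continuous_coord hg k
    fun_prop
  exact hc.integral_hasStrictDerivAt 0 t |>.hasDerivAt

theorem hasDerivAt_cexp_mul (c : ℂ) (t : ℝ) :
    HasDerivAt (fun t : ℝ => Complex.exp (c * t)) (c * Complex.exp (c * t)) t := by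
  have h : HasDerivAt (fun t : ℝ => c * (t : ℂ)) c t := by
    simpa using (Complex.ofRealCLM.hasDerivAt (x := t)).const_mul c
  simpa [mul_comm] using h.cexp

/-- Every Fourier mode of a mild solution solves its scalar differential equation. -/
theorem hasDerivWithinAt_duhamel (hω : 0 ≤ ω) (hlam : ∀ k, (lam k).re ≤ ω) (w₀ : SqSum)
    {g : ℝ → SqSum} (hg : Continuous g) {T t : ℝ} (ht : t ∈ Icc 0 T) (k : ℤ) :
    HasDerivWithinAt (fun t => duhamel lam w₀ g t k) (lam k * duhamel lam w₀ g t k + g t k)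
      (Icc 0 T) t := by
  have h := (hasDerivAt_cexp_mul (lam k) t).mul
    ((hasDerivAt_integral_exp (lam := lam) hg k t).const_add (w₀ k))
  refine (h.hasDerivWithinAt.congr (fun s hs => duhamel_apply hω hlam w₀ hg hs.1 k)
    (duhamel_apply hω hlam w₀ hg ht.1 k)).congr_deriv ?_
  have he : Complex.exp (lam k * t) * Complex.exp (-(lam k * t)) = 1 := by
    rw [← Complex.exp_add, add_neg_cancel, Complex.exp_zero]
  rw [duhamel_apply hω hlam w₀ hg ht.1 k, ← mul_assoc _ (Complex.exp _) (g t k), he]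
  ring

/-- A curve whose Fourier modes solve the scalar equations `wₖ' = λₖ wₖ + gₖ` is given by Duhamel's
formula. -/
theorem eq_duhamel (hω : 0 ≤ ω) (hlam : ∀ k, (lam k).re ≤ ω) {w g : ℝ → SqSum}
    (hg : Continuous g) {T : ℝ}
    (hw : ∀ t ∈ Icc 0 T, ∀ k,
      HasDerivWithinAt (fun t => w t k) (lam k * w t k + g t k) (Icc 0 T) t)
    {t : ℝ} (ht : t ∈ Icc 0 T) : w t = duhamel lam (w 0) g t := by
  ext k
  rw [duhamel_apply hω hlam (w 0) hg ht.1]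
  have hder : ∀ s ∈ Icc 0 T, HasDerivWithinAt
      (fun s : ℝ => Complex.exp (-lam k * s) * w s k) (Complex.exp (-(lam k * s)) * g s k)
      (Icc 0 T) s := fun s hs => by
    refine ((hasDerivAt_cexp_mul (-lam k) s).hasDerivWithinAt.mul (hw s hs k)).congr_deriv ?_
    rw [neg_mul (lam k) (s : ℂ)]
    ring
  have hint : (∫ s in (0 : ℝ)..t, Complex.exp (-(lam k * s)) * g s k) =
      Complex.exp (-lam k * t) * w t k - Complex.exp (-lam k * (0 : ℝ)) * w 0 k := by
    refine intervalIntegral.integral_eq_sub_of_hasDeriv_right_of_le ht.1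
      (fun s hs => ((hder s ⟨hs.1, hs.2.trans ht.2⟩).continuousWithinAt).mono
        (Icc_subset_Icc_right ht.2)) (fun s hs => ?_) ?_
    · refine ((hder s ⟨hs.1.le, hs.2.le.trans ht.2⟩).hasDerivAt ?_).hasDerivWithinAt
      exact Icc_mem_nhds hs.1 (hs.2.trans_le ht.2)
    · have := continuous_coord hg k
      exact (by fun_prop : Continuous fun s : ℝ => Complex.exp (-(lam k * s)) * g s k)
        |>.intervalIntegrable 0 t
  rw [hint]
  have he : Complex.exp (lam k * t) * Complex.exp (-lam k * t) = 1 := by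
    rw [← Complex.exp_add, neg_mul, add_neg_cancel, Complex.exp_zero]
  simp only [Complex.ofReal_zero, mul_zero, Complex.exp_zero, one_mul, add_sub_cancel]
  rw [← mul_assoc, he, one_mul]

theorem norm_duhamel_sub_le (hω : 0 ≤ ω) (hlam : ∀ k, (lam k).re ≤ ω) (w₀ : SqSum)
    {g h : ℝ → SqSum} (hg : Continuous g) (hh : Continuous h) {T t : ℝ} (ht : t ∈ Icc 0 T) :
    ‖duhamel lam w₀ g t - duhamel lam w₀ h t‖ ≤
      ∫ s in (0 : ℝ)..t, Real.exp (ω * T) * ‖g s - h s‖ := by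
  rw [duhamel, duhamel, add_sub_add_left_eq_sub, ← intervalIntegral.integral_sub
    (intervalIntegrable_duhamel hω hlam hg t 0 t) (intervalIntegrable_duhamel hω hlam hh t 0 t)]
  refine intervalIntegral.norm_integral_le_of_norm_le ht.1 (ae_of_all _ fun s hs => ?_)
    ((by fun_prop : Continuous fun s => Real.exp (ω * T) * ‖g s - h s‖).intervalIntegrable 0 t)
  rw [← map_sub]
  exact norm_semigroup_le hω hlam (ht.1.trans ht.2) (by linarith [hs.1, ht.2]) _

theorem duhamel_zero (w₀ : SqSum) (g : ℝ → SqSum) : duhamel lam w₀ g 0 = w₀ := by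
  ext k
  simp only [duhamel, intervalIntegral.integral_same, add_zero]
  rw [semigroup, diag_apply (C := 1) (by simp)]
  simp

end Semigroup

/-- A continuous curve in `ℓ²(ℤ)` is differentiable if its coordinates are and their derivatives
form a continuous curve in `ℓ²(ℤ)`. -/
theorem hasDerivWithinAt_of_coord {T : ℝ} {y V : ℝ → SqSum} (hV : ContinuousOn V (Icc 0 T))
    (hy : ∀ t ∈ Icc 0 T, ∀ k, HasDerivWithinAt (fun t => y t k) (V t k) (Icc 0 T) t)
    {t : ℝ} (ht : t ∈ Icc 0 T) : HasDerivWithinAt y (V t) (Icc 0 T) t := by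
  have hT : (0 : ℝ) ≤ T := ht.1.trans ht.2
  set U : ℝ → SqSum := IccExtend hT ((Icc 0 T).domRestrict V) with hU
  have hUc : Continuous U := (continuousOn_iff_continuous_domRestrict.mp hV).Icc_extend'
  have hUV : ∀ s ∈ Icc 0 T, U s = V s := fun s hs => by
    rw [hU, IccExtend_of_mem hT _ hs, domRestrict_apply]
  -- the integral formula is the case `lam = 0` of Duhamel's formula
  have hrep : ∀ s ∈ Icc 0 T, y s = y 0 + ∫ r in (0 : ℝ)..s, U r := fun s hs => by
    have h := eq_duhamel (lam := 0) (ω := 0) (w := y) (g := U) le_rfl (by simp) hUc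
      (fun r hr k => by simpa [hUV r hr] using hy r hr k) hs
    have hid : ∀ (r : ℝ) (w : SqSum), semigroup 0 r w = w := fun r w => by
      ext k
      rw [semigroup, diag_apply (C := 1) (by simp)]
      simp
    simpa only [duhamel, hid] using h
  rw [← hUV t ht]
  exact ((hUc.integral_hasStrictDerivAt 0 t).hasDerivAt.const_add (y 0)).hasDerivWithinAt.congr
    hrep (hrep t ht)

/-! ### Semilinear equations with a diagonal linear part and a bounded quadratic nonlinearity -/

/-- The curve `w` in `ℓ²(ℤ)` is continuous on `[0, T]` and solves `w' = L w + B(w, w)`, `w(0) = w₀`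
there mode by mode, where `L` is the (possibly unbounded) diagonal operator with entries `lam`. -/
structure IsModeSolution (lam : ℤ → ℂ) (B : SqSum →L[ℂ] SqSum →L[ℂ] SqSum) (T : ℝ) (w₀ : SqSum)
    (w : ℝ → SqSum) : Prop where
  continuousOn : ContinuousOn w (Icc 0 T)
  initial : w 0 = w₀
  deriv : ∀ t ∈ Icc 0 T, ∀ k,
    HasDerivWithinAt (fun t => w t k) (lam k * w t k + B (w t) (w t) k) (Icc 0 T) t

theorem norm_quadratic_sub_le (B : SqSum →L[ℂ] SqSum →L[ℂ] SqSum) {w z : SqSum} {M : ℝ}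
    (hw : ‖w‖ ≤ M) (hz : ‖z‖ ≤ M) : ‖B w w - B z z‖ ≤ 2 * ‖B‖ * M * ‖w - z‖ := by
  have h : B w w - B z z = B (w - z) w + B z (w - z) := by
    simp only [map_sub, sub_apply]
    abel
  calc ‖B w w - B z z‖ ≤ ‖B (w - z) w‖ + ‖B z (w - z)‖ := by rw [h]; exact norm_add_le _ _
    _ ≤ ‖B‖ * ‖w - z‖ * ‖w‖ + ‖B‖ * ‖z‖ * ‖w - z‖ := by
        gcongr <;> exact B.le_opNorm₂ _ _
    _ ≤ ‖B‖ * ‖w - z‖ * M + ‖B‖ * M * ‖w - z‖ := by gcongr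
    _ = 2 * ‖B‖ * M * ‖w - z‖ := by ring

section Semilinear

variable {lam : ℤ → ℂ} {ω : ℝ} {B : SqSum →L[ℂ] SqSum →L[ℂ] SqSum}

/-- Uniqueness, by Grönwall's inequality in Duhamel's formula. -/
theorem IsModeSolution.eqOn (hω : 0 ≤ ω) (hlam : ∀ k, (lam k).re ≤ ω) {T : ℝ} {w₀ : SqSum}
    {w z : ℝ → SqSum} (hw : IsModeSolution lam B T w₀ w) (hz : IsModeSolution lam B T w₀ z) :
    EqOn w z (Icc 0 T) := by
  intro t ht
  have hT : (0 : ℝ) ≤ T := ht.1.trans ht.2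
  obtain ⟨M₁, hM₁⟩ := isCompact_Icc.exists_bound_of_continuousOn hw.continuousOn
  obtain ⟨M₂, hM₂⟩ := isCompact_Icc.exists_bound_of_continuousOn hz.continuousOn
  set W : ℝ → SqSum := IccExtend hT ((Icc 0 T).domRestrict w) with hWdef
  set Z : ℝ → SqSum := IccExtend hT ((Icc 0 T).domRestrict z) with hZdef
  have hWc : Continuous W :=
    (continuousOn_iff_continuous_domRestrict.mp hw.continuousOn).Icc_extend'
  have hZc : Continuous Z :=
    (continuousOn_iff_continuous_domRestrict.mp hz.continuousOn).Icc_extend'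
  have hW : ∀ s ∈ Icc 0 T, W s = w s := fun s hs => by
    rw [hWdef, IccExtend_of_mem hT _ hs, domRestrict_apply]
  have hZ : ∀ s ∈ Icc 0 T, Z s = z s := fun s hs => by
    rw [hZdef, IccExtend_of_mem hT _ hs, domRestrict_apply]
  have hBW : Continuous fun s => B (W s) (W s) := by fun_prop
  have hBZ : Continuous fun s => B (Z s) (Z s) := by fun_prop
  have hwd : ∀ s ∈ Icc 0 T, w s = duhamel lam w₀ (fun s => B (W s) (W s)) s := fun s hs => by
    rw [← hw.initial]
    exact eq_duhamel hω hlam hBW (fun r hr k => by rw [hW r hr]; exact hw.deriv r hr k) hs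
  have hzd : ∀ s ∈ Icc 0 T, z s = duhamel lam w₀ (fun s => B (Z s) (Z s)) s := fun s hs => by
    rw [← hz.initial]
    exact eq_duhamel hω hlam hBZ (fun r hr k => by rw [hZ r hr]; exact hz.deriv r hr k) hs
  set K : ℝ := Real.exp (ω * T) * (2 * ‖B‖ * max M₁ M₂) with hK
  have hdc : Continuous fun s => ‖W s - Z s‖ := by fun_prop
  have hbound : ∀ s ∈ Icc 0 T, ‖W s - Z s‖ ≤ K * ∫ r in (0 : ℝ)..s, ‖W r - Z r‖ := fun s hs => by
    rw [hW s hs, hZ s hs, hwd s hs, hzd s hs, ← intervalIntegral.integral_const_mul]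
    refine (norm_duhamel_sub_le hω hlam w₀ hBW hBZ hs).trans ?_
    refine intervalIntegral.integral_mono_on hs.1
      ((by fun_prop : Continuous fun s =>
        Real.exp (ω * T) * ‖B (W s) (W s) - B (Z s) (Z s)‖).intervalIntegrable 0 s)
      ((hdc.const_mul K).intervalIntegrable 0 s) fun r hr => ?_
    have hr' : r ∈ Icc 0 T := ⟨hr.1, hr.2.trans hs.2⟩
    rw [hK, mul_assoc]
    gcongr
    refine norm_quadratic_sub_le B ?_ ?_
    · rw [hW r hr']; exact (hM₁ r hr').trans (le_max_left _ _)
    · rw [hZ r hr']; exact (hM₂ r hr').trans (le_max_right _ _)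
  have hD : ∀ s ∈ Icc 0 T, ∫ r in (0 : ℝ)..s, ‖W r - Z r‖ = 0 := by
    have hder : ∀ s, HasDerivAt (fun s => ∫ r in (0 : ℝ)..s, ‖W r - Z r‖) ‖W s - Z s‖ s :=
      fun s => (hdc.integral_hasStrictDerivAt 0 s).hasDerivAt
    refine eq_zero_of_abs_deriv_le_mul_abs_self_of_eq_zero_right (K := K)
      (f' := fun s => ‖W s - Z s‖)
      (fun s _ => (hder s).continuousAt.continuousWithinAt)
      (fun s _ => (hder s).hasDerivWithinAt) intervalIntegral.integral_same fun s hs => ?_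
    rw [norm_norm, Real.norm_of_nonneg
      (intervalIntegral.integral_nonneg hs.1 fun _ _ => norm_nonneg _)]
    exact hbound s ⟨hs.1, hs.2.le⟩
  have h0 := hbound t ht
  rw [hD t ht, mul_zero, hW t ht, hZ t ht] at h0
  exact sub_eq_zero.mp (norm_le_zero_iff.mp h0)

/-- An existence time for data of norm at most `R`, for a linear part with growth bound `ω` and a
quadratic nonlinearity of norm `b`. -/
def existenceTime (ω b R : ℝ) : ℝ :=
  min 1 (1 / (8 * (Real.exp ω * (b + 1)) * (Real.exp ω * (R + 1))))

theorem existenceTime_pos {ω b R : ℝ} (hb : 0 ≤ b) (hR : 0 ≤ R) : 0 < existenceTime ω b R :=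
  lt_min one_pos (by positivity)

/-- Local existence, by the contraction principle for Duhamel's formula on a ball of
`C([0, T]; ℓ²)`. -/
theorem exists_isModeSolution (hω : 0 ≤ ω) (hlam : ∀ k, (lam k).re ≤ ω) {R : ℝ} {w₀ : SqSum}
    (hw₀ : ‖w₀‖ ≤ R) : ∃ w, IsModeSolution lam B (existenceTime ω ‖B‖ R) w₀ w := by
  have hR : 0 ≤ R := (norm_nonneg _).trans hw₀
  have hTpos : 0 < existenceTime ω ‖B‖ R := existenceTime_pos (norm_nonneg B) hR
  set T := existenceTime ω ‖B‖ R with hTdef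
  have hT : 0 ≤ T := hTpos.le
  set M := Real.exp ω with hM
  have hMpos : 0 < M := Real.exp_pos _
  have hMT : Real.exp (ω * T) ≤ M :=
    Real.exp_le_exp.mpr (mul_le_of_le_one_right hω (min_le_left _ _))
  -- twice the norm that the linear flow can reach
  set r := 2 * (M * (R + 1)) with hr
  have hrpos : 0 < r := by positivity
  have hTsmall : M * (2 * ‖B‖ * r) * T ≤ 1 / 2 := by
    have h1 : T * (8 * (M * (‖B‖ + 1)) * (M * (R + 1))) ≤ 1 := by
      rw [← le_div_iff₀ (by positivity)]
      exact min_le_right _ _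
    have h2 : M * (2 * ‖B‖ * r) * T ≤ M * (2 * (‖B‖ + 1) * r) * T := by
      gcongr
      linarith
    calc _ ≤ _ := h2
      _ = T * (8 * (M * (‖B‖ + 1)) * (M * (R + 1))) / 2 := by rw [hr]; ring
      _ ≤ 1 / 2 := by linarith
  let N : C(Icc 0 T, SqSum) → ℝ → SqSum := fun v s => B (IccExtend hT v s) (IccExtend hT v s)
  have hN : ∀ v, Continuous (N v) := fun v => by
    have : Continuous (IccExtend hT v) := v.continuous.Icc_extend'
    fun_prop
  let Φ : C(Icc 0 T, SqSum) → C(Icc 0 T, SqSum) := fun v =>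
    ⟨fun t => duhamel lam w₀ (N v) t,
      (continuous_duhamel hω hlam w₀ (hN v)).comp continuous_subtype_val⟩
  have hnorm : ∀ v ∈ Metric.closedBall (0 : C(Icc 0 T, SqSum)) r, ∀ s,
      ‖IccExtend hT v s‖ ≤ r := fun v hv s =>
    (v.norm_coe_le_norm _).trans (mem_closedBall_zero_iff.mp hv)
  have hdiff : ∀ v ∈ Metric.closedBall (0 : C(Icc 0 T, SqSum)) r,
      ∀ v' ∈ Metric.closedBall (0 : C(Icc 0 T, SqSum)) r, dist (Φ v) (Φ v') ≤ 1 / 2 * dist v v' := by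
    intro v hv v' hv'
    rw [ContinuousMap.dist_le (by positivity)]
    intro t
    rw [dist_eq_norm]
    refine (norm_duhamel_sub_le hω hlam w₀ (hN v) (hN v') t.2).trans ?_
    have hle : ∀ s ∈ Icc 0 (t : ℝ), Real.exp (ω * T) * ‖N v s - N v' s‖ ≤
        M * (2 * ‖B‖ * r) * dist v v' := fun s _ => by
      have h1 := norm_quadratic_sub_le B (hnorm v hv s) (hnorm v' hv' s)
      have h2 : ‖IccExtend hT v s - IccExtend hT v' s‖ ≤ dist v v' := by
        rw [← dist_eq_norm]
        exact ContinuousMap.dist_apply_le_dist _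
      calc Real.exp (ω * T) * ‖N v s - N v' s‖
          ≤ M * (2 * ‖B‖ * r * ‖IccExtend hT v s - IccExtend hT v' s‖) := by gcongr
        _ ≤ M * (2 * ‖B‖ * r * dist v v') := by gcongr
        _ = M * (2 * ‖B‖ * r) * dist v v' := by ring
    have hc : Continuous fun s => Real.exp (ω * T) * ‖N v s - N v' s‖ :=
      (((hN v).sub (hN v')).norm).const_mul _
    calc _ ≤ ∫ _ in (0 : ℝ)..t, M * (2 * ‖B‖ * r) * dist v v' :=
          intervalIntegral.integral_mono_on t.2.1 (hc.intervalIntegrable _ _)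
            (intervalIntegrable_const) hle
      _ = M * (2 * ‖B‖ * r) * t * dist v v' := by
          rw [intervalIntegral.integral_const, sub_zero, smul_eq_mul]
          ring
      _ ≤ M * (2 * ‖B‖ * r) * T * dist v v' := by
          gcongr
          exact t.2.2
      _ ≤ 1 / 2 * dist v v' := by gcongr
  have h0mem : (0 : C(Icc 0 T, SqSum)) ∈ Metric.closedBall (0 : C(Icc 0 T, SqSum)) r :=
    Metric.mem_closedBall_self hrpos.le
  have hΦ0 : ‖Φ 0‖ ≤ r / 2 := by
    rw [ContinuousMap.norm_le _ (by positivity)]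
    intro t
    have hN0 : N 0 = 0 := by
      funext s
      have : IccExtend hT (⇑(0 : C(Icc 0 T, SqSum))) s = 0 := rfl
      simp only [N, this, map_zero, Pi.zero_apply]
    have : Φ 0 t = semigroup lam t w₀ := by
      change duhamel lam w₀ (N 0) t = _
      simp [hN0, duhamel]
    rw [this]
    calc ‖semigroup lam t w₀‖ ≤ Real.exp (ω * T) * ‖w₀‖ :=
          norm_semigroup_le hω hlam hT t.2.2 w₀
      _ ≤ M * (R + 1) := by gcongr; linarith
      _ = r / 2 := by rw [hr]; ring
  have hmaps : MapsTo Φ (Metric.closedBall 0 r) (Metric.closedBall 0 r) := fun v hv => by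
    have h1 := hdiff v hv 0 h0mem
    rw [mem_closedBall_zero_iff] at hv ⊢
    rw [dist_zero_right] at h1
    have h2 : ‖Φ v‖ ≤ dist (Φ v) (Φ 0) + ‖Φ 0‖ := by
      rw [← dist_zero_right, ← dist_zero_right]
      exact dist_triangle _ _ _
    linarith
  have hcontr : ContractingWith (1 / 2) (hmaps.restrict Φ _ _) := by
    refine ⟨by rw [← NNReal.coe_lt_coe]; norm_num, LipschitzWith.of_dist_le_mul fun v v' => ?_⟩
    rw [show ((1 / 2 : NNReal) : ℝ) = 1 / 2 by norm_num]
    exact hdiff v v.2 v' v'.2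
  obtain ⟨v, -, hv, -⟩ := hcontr.exists_fixedPoint' Metric.isClosed_closedBall.isComplete hmaps
    h0mem (edist_ne_top _ _)
  have hvN : ∀ t ∈ Icc 0 T, duhamel lam w₀ (N v) t = IccExtend hT v t := fun t ht => by
    rw [IccExtend_of_mem hT _ ht]
    exact congrArg (fun f : C(Icc 0 T, SqSum) => f ⟨t, ht⟩) hv
  refine ⟨duhamel lam w₀ (N v), (continuous_duhamel hω hlam w₀ (hN v)).continuousOn,
    duhamel_zero w₀ _, fun t ht k => ?_⟩
  have h := hasDerivWithinAt_duhamel hω hlam w₀ (hN v) ht k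
  have hB : B (duhamel lam w₀ (N v) t) (duhamel lam w₀ (N v) t) = N v t := by rw [hvN t ht]
  rwa [hB]

end Semilinear

/-! ### Fourier coefficients of products -/

theorem coef_apply (f : L2T) (k : ℤ) : coef f k = fourierBasis.repr f k :=
  (fourierBasis_repr f k).symm

theorem coef_injective : Function.Injective coef := fun f g h => by
  refine fourierBasis.repr.injective ?_
  ext k
  rw [← coef_apply, ← coef_apply, h]

theorem coef_toL2 {u : PerDist} (hu : Memℓp u 2) : coef (toL2 u) = u := by
  funext k
  rw [coef_apply, toL2, dif_pos hu, LinearIsometryEquiv.apply_symm_apply]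

/-- The Fourier coefficients of the product of two `L²` functions are the convolution of their
Fourier coefficients, by Parseval's identity. -/
theorem hasSum_prodD {u v : PerDist} (hu : Memℓp u 2) (hv : Memℓp v 2) (k : ℤ) :
    HasSum (fun j => u j * v (k - j)) (prodD u v k) := by
  set f := toL2 u with hf
  set g := toL2 v with hg
  have hmem : MemLp (fun x : Torus => fourier k x * conj (g x)) 2 AddCircle.haarAddCircle := by
    refine (Lp.memLp g).of_le (((fourier k).continuous.aestronglyMeasurable).mul
      (Complex.continuous_conj.comp_aestronglyMeasurable (Lp.aestronglyMeasurable g)))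
      (ae_of_all _ fun x => ?_)
    rw [norm_mul, RCLike.norm_conj, fourier_apply, Circle.norm_coe, one_mul]
  have hcoe := hmem.coeFn_toLp
  set h : L2T := hmem.toLp _ with hh
  have hsum := fourierBasis.hasSum_inner_mul_inner h f
  have hval : inner ℂ h f = prodD u v k := by
    rw [L2.inner_def, prodD, fourierCoeff]
    refine integral_congr_ae ?_
    filter_upwards [hcoe] with x hx
    rw [hx, RCLike.inner_apply', map_mul, RCLike.conj_conj, smul_eq_mul, fourier_neg]
    ring
  rw [hval] at hsum
  refine hsum.congr_fun fun j => ?_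
  rw [← fourierBasis.repr_apply_apply, ← coef_apply, hf, coef_toL2 hu, mul_comm]
  congr 1
  rw [← congrFun (coef_toL2 hv) (k - j), ← hg, coef, fourierCoeff, L2.inner_def]
  refine integral_congr_ae ?_
  filter_upwards [hcoe, coeFn_fourierLp (T := 2 * Real.pi) 2 j] with x hx hj
  rw [hx, coe_fourierBasis, hj, RCLike.inner_apply', map_mul, RCLike.conj_conj, smul_eq_mul,
    ← fourier_neg, neg_sub, sub_eq_add_neg, fourier_add]
  ring

/-- The Leibniz rule. -/
theorem prodD_dxi {u v : PerDist} (hu : Memℓp u 2) (hv : Memℓp v 2) (hu' : Memℓp (dxi u) 2)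
    (hv' : Memℓp (dxi v) 2) (k : ℤ) :
    Complex.I * k * prodD u v k = prodD (dxi u) v k + prodD u (dxi v) k := by
  refine ((hasSum_prodD hu hv k).mul_left (Complex.I * k)).unique
    (((hasSum_prodD hu' hv k).add (hasSum_prodD hu hv' k)).congr_fun fun j => ?_)
  simp only [dxi, mult]
  push_cast
  ring

/-! ### The space `H²(𝕋)` as a weighted sequence space -/

/-- The weight `1 + k²` that measures `H²(𝕋)` on the Fourier side. -/
def weight (k : ℤ) : ℂ := ((1 + (k : ℝ) ^ 2 : ℝ) : ℂ)

theorem norm_weight (k : ℤ) : ‖weight k‖ = 1 + (k : ℝ) ^ 2 := by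
  rw [weight, Complex.norm_real, Real.norm_of_nonneg (by positivity)]

theorem weight_ne_zero (k : ℤ) : weight k ≠ 0 := by
  rw [← norm_ne_zero_iff, norm_weight]
  positivity

theorem norm_div_weight_le {s : ℤ → ℂ} {C : ℝ} (hs : ∀ k : ℤ, ‖s k‖ ≤ C * (1 + (k : ℝ) ^ 2))
    (k : ℤ) : ‖s k / weight k‖ ≤ C := by
  rw [norm_div, norm_weight, div_le_iff₀ (by positivity)]
  exact hs k

/-- The periodic distribution with Fourier coefficients `w k / (1 + k²)`, which is the general form
of an element of `H²(𝕋)`. -/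
def unweight (w : SqSum) : PerDist := fun k => w k / weight k

theorem memℓp_mult_unweight {s : ℤ → ℂ} {C : ℝ} (hs : ∀ k : ℤ, ‖s k‖ ≤ C * (1 + (k : ℝ) ^ 2))
    (w : SqSum) : Memℓp (mult s (unweight w)) 2 := by
  have h := memℓp_bounded_mul (norm_div_weight_le hs) w
  convert h using 2 with k
  simp only [mult, unweight]
  ring

theorem summable_inv_one_add_sq : Summable fun k : ℤ => (1 + (k : ℝ) ^ 2)⁻¹ := by
  have h := Real.summable_one_div_int_pow (p := 2) |>.mpr one_lt_two
  refine Summable.of_norm_bounded_eventually h ?_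
  filter_upwards [(finite_singleton (0 : ℤ)).compl_mem_cofinite] with k hk
  have hk : (k : ℝ) ≠ 0 := by exact_mod_cast hk
  rw [Real.norm_of_nonneg (by positivity), one_div]
  gcongr
  linarith

/-- The square-summable sequence `s k / (1 + k²)` for a symbol `s` of order one. -/
def lowWeight (s : ℤ → ℂ) (hs : ∀ k : ℤ, ‖s k‖ ^ 2 ≤ 1 + (k : ℝ) ^ 2) : SqSum :=
  ⟨fun k => s k / weight k, by
    refine memℓp_two_iff.mpr (summable_inv_one_add_sq.of_nonneg_of_le (fun k => by positivity)
      fun k => ?_)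
    rw [norm_div, norm_weight, div_pow, div_le_iff₀ (by positivity), sq (1 + (k : ℝ) ^ 2),
      inv_mul_cancel_left₀ (by positivity)]
    exact hs k⟩

theorem lowWeight_apply {s : ℤ → ℂ} (hs : ∀ k : ℤ, ‖s k‖ ^ 2 ≤ 1 + (k : ℝ) ^ 2) (k : ℤ) :
    lowWeight s hs k = s k / weight k := rfl

/-- Products with a factor of order one and a factor of order two are bounded from `H² × H²` to
`L²`. -/
theorem prodD_mult_unweight {s s' : ℤ → ℂ} (hs : ∀ k : ℤ, ‖s k‖ ^ 2 ≤ 1 + (k : ℝ) ^ 2)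
    (hs' : ∀ k : ℤ, ‖s' k‖ ≤ 1 * (1 + (k : ℝ) ^ 2)) (w z : SqSum) (k : ℤ) :
    prodD (mult s (unweight w)) (mult s' (unweight z)) k =
      conv (lowWeight s hs) w (diag (fun k => s' k / weight k) z) k := by
  have hs1 : ∀ k : ℤ, ‖s k‖ ≤ 1 * (1 + (k : ℝ) ^ 2) := fun k => by
    nlinarith [hs k, sq_nonneg (‖s k‖ - 1), sq_nonneg (k : ℝ)]
  refine (hasSum_prodD (memℓp_mult_unweight hs1 w) (memℓp_mult_unweight hs' z) k).unique
    ((hasSum_conv _ w _ k).congr_fun fun j => ?_)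
  rw [diag_apply (norm_div_weight_le hs'), lowWeight_apply]
  simp only [mult, unweight]
  ring

/-! ### Symbols -/

/-- The symbol `ik` of `∂_ξ`. -/
def symD (k : ℤ) : ℂ := Complex.I * k

/-- The symbol `|k|` of `Λ`. -/
def symLam (k : ℤ) : ℂ := ((|(k : ℝ)| : ℝ) : ℂ)

/-- The symbol `-i sgn k` of `ℋ`. -/
def symH (k : ℤ) : ℂ := -Complex.I * (Int.sign k : ℂ)

/-- The symbol of `a + bℋ`. -/
def symAB (Υ δ : ℝ) (k : ℤ) : ℂ :=
  ((2 * (1 + Υ * |(k : ℝ)|) / den Υ δ k : ℝ) : ℂ) +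
    ((δ * |(k : ℝ)| ^ 2 / den Υ δ k : ℝ) : ℂ) * symH k

/-- The symbol of `(I + ΥΛ)∂_ξ + (β/4) Λ ∂_ξ³ + δ Λ ∂_ξ² + ℋ`. -/
def symLin (Υ δ β : ℝ) (k : ℤ) : ℂ :=
  symD k + (Υ : ℂ) * (symLam k * symD k)
    + ((β / 4 : ℝ) : ℂ) * (symLam k * (symD k * (symD k * symD k)))
    + (δ : ℂ) * (symLam k * (symD k * symD k)) + symH k

/-- The symbol of the linear part of the equation. -/
def symModel (ε Υ δ β : ℝ) (k : ℤ) : ℂ := ((1 / ε : ℝ) : ℂ) * (symAB Υ δ k * symLin Υ δ β k)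

theorem abs_le_sq (k : ℤ) : |(k : ℝ)| ≤ (k : ℝ) ^ 2 := by
  have h : |k| ≤ k ^ 2 := by
    rw [← sq_abs]
    nlinarith [abs_nonneg k, Int.le_self_sq |k|]
  exact_mod_cast h

theorem norm_symD (k : ℤ) : ‖symD k‖ = |(k : ℝ)| := by simp [symD]

theorem norm_symLam (k : ℤ) : ‖symLam k‖ = |(k : ℝ)| := by simp [symLam]

theorem norm_symH_le (k : ℤ) : ‖symH k‖ ≤ 1 := by
  rcases lt_trichotomy k 0 with h | h | h
  · simp [symH, Int.sign_eq_neg_one_of_neg h]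
  · simp [symH, h]
  · simp [symH, Int.sign_eq_one_of_pos h]

theorem symH_mul_symD (k : ℤ) : symH k * symD k = symLam k := by
  have h : (k.sign : ℝ) * (k : ℝ) = |(k : ℝ)| := by exact_mod_cast Int.sign_mul_self_eq_abs k
  rw [symLam, ← h, symH, symD]
  push_cast
  linear_combination (-(k.sign : ℂ) * k) * Complex.I_mul_I

theorem symD_neg (k : ℤ) : symD (-k) = conj (symD k) := by simp [symD]

theorem symLam_neg (k : ℤ) : symLam (-k) = conj (symLam k) := by simp [symLam]

theorem symH_neg (k : ℤ) : symH (-k) = conj (symH k) := by simp [symH]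

theorem den_neg (Υ δ : ℝ) (k : ℤ) : den Υ δ (-k) = den Υ δ k := by simp [den]

theorem symAB_neg (Υ δ : ℝ) (k : ℤ) : symAB Υ δ (-k) = conj (symAB Υ δ k) := by
  simp only [symAB, symH_neg, den_neg, map_add, map_mul, Complex.conj_ofReal, Int.cast_neg, abs_neg]

theorem symModel_neg (ε Υ δ β : ℝ) (k : ℤ) :
    symModel ε Υ δ β (-k) = conj (symModel ε Υ δ β k) := by
  simp only [symModel, symLin, symAB_neg, symD_neg, symLam_neg, symH_neg, map_add, map_mul,
    Complex.conj_ofReal]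

theorem weight_neg (k : ℤ) : weight (-k) = weight k := by simp [weight]

section Bounds

variable {ε Υ δ β : ℝ}

theorem den_pos (hΥ : 0 < Υ) (k : ℤ) : 0 < den Υ δ k := by
  unfold den
  positivity

/-- The operator `a + bℋ` gains two derivatives. -/
theorem norm_symAB_mul_weight_le (hΥ : 0 < Υ) (hδ : 0 < δ) (k : ℤ) :
    ‖symAB Υ δ k‖ * (1 + (k : ℝ) ^ 2) ≤ 2 + 2 / δ := by
  have hd := den_pos (δ := δ) hΥ k
  set p : ℝ := 1 + Υ * |(k : ℝ)| with hp
  have hp1 : 1 ≤ p := by rw [hp]; linarith [mul_nonneg hΥ.le (abs_nonneg (k : ℝ))]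
  set q : ℝ := δ * |(k : ℝ)| ^ 2 with hq
  have hq0 : 0 ≤ q := by positivity
  have hden : den Υ δ k = 4 * p ^ 2 + q ^ 2 := by
    rw [hp, hq, den, ← sq_abs (k : ℝ)]
    ring
  have hk : (k : ℝ) ^ 2 = q / δ := by rw [hq, sq_abs]; field_simp
  have h1 : ‖symAB Υ δ k‖ ≤ (2 * p + q) / den Υ δ k := by
    calc ‖symAB Υ δ k‖ ≤ 2 * p / den Υ δ k + q / den Υ δ k * 1 := by
          refine (norm_add_le _ _).trans ?_
          rw [norm_mul, Complex.norm_real, Complex.norm_real,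
            Real.norm_of_nonneg (by positivity), Real.norm_of_nonneg (by positivity)]
          gcongr
          exact norm_symH_le k
      _ = (2 * p + q) / den Υ δ k := by ring
  calc ‖symAB Υ δ k‖ * (1 + (k : ℝ) ^ 2) ≤ (2 * p + q) / den Υ δ k * (1 + q / δ) := by
        rw [hk]; gcongr
    _ = ((2 * p + q) + (2 * p * q + q ^ 2) / δ) / den Υ δ k := by field_simp
    _ ≤ 2 + 2 / δ := by
        rw [div_le_iff₀ hd, hden, add_mul, div_mul_eq_mul_div]
        gcongr
        · nlinarith [sq_nonneg (q - 1)]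
        · nlinarith [sq_nonneg (2 * p - q)]

theorem norm_symLin_le (hΥ : 0 < Υ) (hδ : 0 < δ) (hβ : 0 < β) (k : ℤ) :
    ‖symLin Υ δ β k‖ ≤ (2 + Υ + β / 4 + δ) * (1 + (k : ℝ) ^ 2) ^ 2 := by
  set x := |(k : ℝ)| with hx
  have hx0 : 0 ≤ x := abs_nonneg _
  have hxk : (k : ℝ) ^ 2 = x ^ 2 := (sq_abs _).symm
  have h : ‖symLin Υ δ β k‖ ≤ x + Υ * (x * x) + β / 4 * (x * (x * (x * x))) + δ * (x * (x * x))
      + 1 := by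
    refine (norm_add_le _ _).trans (add_le_add ?_ (norm_symH_le k))
    refine (norm_add_le _ _).trans (add_le_add ?_ (le_of_eq ?_))
    · refine (norm_add_le _ _).trans (add_le_add ?_ (le_of_eq ?_))
      · refine (norm_add_le _ _).trans (add_le_add (le_of_eq ?_) (le_of_eq ?_))
        · rw [norm_symD]
        · rw [norm_mul, norm_mul, norm_symD, norm_symLam, Complex.norm_real,
            Real.norm_of_nonneg hΥ.le]
      · simp only [norm_mul, norm_symD, norm_symLam, Complex.norm_real]
        rw [Real.norm_of_nonneg (by positivity)]
    · simp only [norm_mul, norm_symD, norm_symLam, Complex.norm_real]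
      rw [Real.norm_of_nonneg hδ.le]
  rw [hxk]
  have h1 : x ≤ (1 + x ^ 2) ^ 2 := by nlinarith [sq_nonneg (x - 1), sq_nonneg (x ^ 2)]
  have h2 : x * x ≤ (1 + x ^ 2) ^ 2 := by nlinarith [sq_nonneg (x ^ 2)]
  have h3 : x * (x * x) ≤ (1 + x ^ 2) ^ 2 := by
    nlinarith [sq_nonneg (x - 1), mul_nonneg (sq_nonneg x) (sq_nonneg (x - 1)), sq_nonneg (x ^ 2)]
  have h4 : x * (x * (x * x)) ≤ (1 + x ^ 2) ^ 2 := by nlinarith [sq_nonneg x]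
  have h5 : 1 ≤ (1 + x ^ 2) ^ 2 := by nlinarith [sq_nonneg x, sq_nonneg (x ^ 2)]
  calc _ ≤ _ := h
    _ ≤ (1 + x ^ 2) ^ 2 + Υ * (1 + x ^ 2) ^ 2 + β / 4 * (1 + x ^ 2) ^ 2 + δ * (1 + x ^ 2) ^ 2
        + (1 + x ^ 2) ^ 2 := by gcongr
    _ = _ := by ring

/-- The linear part of the equation is of order two. -/
theorem norm_symModel_le (hε : 0 < ε) (hΥ : 0 < Υ) (hδ : 0 < δ) (hβ : 0 < β) (k : ℤ) :
    ‖symModel ε Υ δ β k‖ ≤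
      1 / ε * ((2 + 2 / δ) * (2 + Υ + β / 4 + δ)) * (1 + (k : ℝ) ^ 2) := by
  rw [symModel, norm_mul, norm_mul, Complex.norm_real, Real.norm_of_nonneg (by positivity)]
  calc 1 / ε * (‖symAB Υ δ k‖ * ‖symLin Υ δ β k‖)
      ≤ 1 / ε * (‖symAB Υ δ k‖ * ((2 + Υ + β / 4 + δ) * (1 + (k : ℝ) ^ 2) ^ 2)) := by
        gcongr
        exact norm_symLin_le hΥ hδ hβ k
    _ = 1 / ε * (‖symAB Υ δ k‖ * (1 + (k : ℝ) ^ 2) *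
          ((2 + Υ + β / 4 + δ) * (1 + (k : ℝ) ^ 2))) := by ring
    _ ≤ 1 / ε * ((2 + 2 / δ) * ((2 + Υ + β / 4 + δ) * (1 + (k : ℝ) ^ 2))) := by
        gcongr
        exact norm_symAB_mul_weight_le hΥ hδ k
    _ = _ := by ring

/-- The linear part of the equation generates a semigroup on `ℓ²(ℤ)`: its two top order terms
`-δ a Λ³` and `-(β/4) b Λ⁴` are dissipative, and the only positive contribution to the real part,
that of `b Λ(I + ΥΛ)`, is bounded. -/
theorem re_symModel_le (hε : 0 < ε) (hΥ : 0 < Υ) (hδ : 0 < δ) (hβ : 0 < β) (k : ℤ) :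
    (symModel ε Υ δ β k).re ≤ 1 / ε * ((1 + Υ) / δ) := by
  rw [symModel, Complex.re_ofReal_mul]
  gcongr
  have hd := den_pos (δ := δ) hΥ k
  set x := |(k : ℝ)| with hx
  have hx0 : 0 ≤ x := abs_nonneg _
  set s : ℝ := (k.sign : ℝ) with hs
  have hsk : s * k = x := by
    rw [hs, hx]
    exact_mod_cast Int.sign_mul_self_eq_abs k
  set a : ℝ := 2 * (1 + Υ * x) / den Υ δ k with ha
  have ha0 : 0 ≤ a := by positivity
  set b : ℝ := δ * x ^ 2 / den Υ δ k with hb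
  have hb0 : 0 ≤ b := by positivity
  have hre : (symAB Υ δ k * symLin Υ δ β k).re =
      -(a * δ * x * k ^ 2) + b * (s * k + Υ * x * (s * k) - β / 4 * x * (s * k) * k ^ 2 - s ^ 2) := by
    have e1 : symAB Υ δ k = ⟨a, -(b * s)⟩ := by
      apply Complex.ext <;> simp [symAB, symH, ← hx, ← hs, ← ha, ← hb]
    have e2 : symLin Υ δ β k =
        ⟨-(δ * x * k ^ 2), k + Υ * x * k - β / 4 * x * k ^ 3 - s⟩ := by
      apply Complex.ext <;> simp [symLin, symD, symLam, symH, ← hx, ← hs] <;> ring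
    rw [e1, e2, Complex.mul_re]
    ring
  have hbk : b * x ^ 2 ≤ 1 / δ := by
    have hden : den Υ δ k = 4 * (1 + Υ * x) ^ 2 + (δ * x ^ 2) ^ 2 := by
      rw [hx, den, ← sq_abs (k : ℝ)]
      ring
    rw [hb, div_mul_eq_mul_div, div_le_div_iff₀ hd hδ, hden]
    nlinarith [sq_nonneg (1 + Υ * x)]
  have hxx : x ≤ x ^ 2 := by rw [hx, sq_abs]; exact abs_le_sq k
  rw [hre, hsk]
  calc _ = b * (x + Υ * x ^ 2) - (a * δ * x * k ^ 2 + b * (β / 4 * x ^ 2 * k ^ 2 + s ^ 2)) := by ring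
    _ ≤ b * (x + Υ * x ^ 2) := sub_le_self _ (by positivity)
    _ ≤ b * (x ^ 2 + Υ * x ^ 2) := by gcongr
    _ = (1 + Υ) * (b * x ^ 2) := by ring
    _ ≤ (1 + Υ) * (1 / δ) := by gcongr
    _ = (1 + Υ) / δ := by ring

end Bounds

/-! ### The quadratic nonlinearity on `H²(𝕋)` -/

theorem norm_one_sq_le (k : ℤ) : ‖(1 : ℂ)‖ ^ 2 ≤ 1 + (k : ℝ) ^ 2 := by
  rw [norm_one]
  nlinarith [sq_nonneg (k : ℝ)]

theorem norm_symD_sq_le (k : ℤ) : ‖symD k‖ ^ 2 ≤ 1 + (k : ℝ) ^ 2 := by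
  rw [norm_symD, sq_abs]
  linarith

theorem norm_one_le (k : ℤ) : ‖(1 : ℂ)‖ ≤ 1 * (1 + (k : ℝ) ^ 2) := by
  rw [norm_one]
  nlinarith [sq_nonneg (k : ℝ)]

theorem norm_symD_le (k : ℤ) : ‖symD k‖ ≤ 1 * (1 + (k : ℝ) ^ 2) := by
  rw [norm_symD]
  linarith [abs_le_sq k]

theorem norm_symLam_le (k : ℤ) : ‖symLam k‖ ≤ 1 * (1 + (k : ℝ) ^ 2) := by
  rw [norm_symLam]
  linarith [abs_le_sq k]

theorem norm_symD_mul_symD_le (k : ℤ) : ‖symD k * symD k‖ ≤ 1 * (1 + (k : ℝ) ^ 2) := by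
  rw [norm_mul, norm_symD, abs_mul_abs_self]
  linarith [sq (k : ℝ)]

theorem norm_symLam_mul_symD_le (k : ℤ) : ‖symLam k * symD k‖ ≤ 1 * (1 + (k : ℝ) ^ 2) := by
  rw [norm_mul, norm_symD, norm_symLam, abs_mul_abs_self]
  linarith [sq (k : ℝ)]

theorem norm_neg_symAB_mul_weight_le {Υ δ : ℝ} (hΥ : 0 < Υ) (hδ : 0 < δ) (k : ℤ) :
    ‖-(symAB Υ δ k * weight k)‖ ≤ 2 + 2 / δ := by
  rw [norm_neg, norm_mul, norm_weight]
  exact norm_symAB_mul_weight_le hΥ hδ k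

/-- The bounded bilinear form on `ℓ²(ℤ)` which, in the weighted Fourier coefficients of `H²(𝕋)`, is
`-(a + bℋ)(2 u_ξ Λv - Λ(u v_ξ) + u Λv_ξ)`; the derivative in `Λ(u v_ξ) = ℋ(u_ξ v_ξ + u v_ξξ)` is
carried out. -/
def quadForm (Υ δ : ℝ) : SqSum →L[ℂ] SqSum →L[ℂ] SqSum :=
  let σ₀ := conv (lowWeight (fun _ => 1) norm_one_sq_le)
  let σ₁ := conv (lowWeight symD norm_symD_sq_le)
  let post := fun (A : SqSum →L[ℂ] SqSum) (P : SqSum →L[ℂ] SqSum →L[ℂ] SqSum) =>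
    (ContinuousLinearMap.compL ℂ SqSum SqSum SqSum A).comp P
  let right := fun (P : SqSum →L[ℂ] SqSum →L[ℂ] SqSum) (s : ℤ → ℂ) =>
    P.bilinearComp (ContinuousLinearMap.id ℂ SqSum) (diag fun k => s k / weight k)
  post (diag fun k => -(symAB Υ δ k * weight k))
    ((2 : ℂ) • right σ₁ symLam
      - post (diag symH) (right σ₁ symD + right σ₀ fun k => symD k * symD k)
      + right σ₀ fun k => symLam k * symD k)

theorem quadForm_apply (Υ δ : ℝ) (w z : SqSum) :
    quadForm Υ δ w z = diag (fun k => -(symAB Υ δ k * weight k))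
      ((2 : ℂ) • conv (lowWeight symD norm_symD_sq_le) w (diag (fun k => symLam k / weight k) z)
      - diag symH (conv (lowWeight symD norm_symD_sq_le) w (diag (fun k => symD k / weight k) z)
        + conv (lowWeight (fun _ => 1) norm_one_sq_le) w
            (diag (fun k => symD k * symD k / weight k) z))
      + conv (lowWeight (fun _ => 1) norm_one_sq_le) w
          (diag (fun k => symLam k * symD k / weight k) z)) := rfl

/-- The right-hand side of the equation in weighted Fourier coefficients: a diagonal operator plus a
bounded quadratic map. -/
theorem modelRHS_unweight {ε Υ δ β : ℝ} (hΥ : 0 < Υ) (hδ : 0 < δ) (w : SqSum) (k : ℤ) :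
    modelRHS ε Υ δ β (unweight w) k =
      (symModel ε Υ δ β k * w k + quadForm Υ δ w w k) / weight k := by
  have hAB : ∀ u : PerDist, abH Υ δ u k = symAB Υ δ k * u k := fun u => by
    simp only [abH, aOp, bOp, Hilb, mult, symAB, symH, Pi.add_apply]
    ring
  have hLin : linPart Υ δ β (unweight w) k = symLin Υ δ β k * unweight w k := by
    simp only [linPart, dxi, Lam, Hilb, mult, symLin, symD, symLam, symH, Pi.add_apply,
      Pi.smul_apply, smul_eq_mul]
    ring
  have h1 : unweight w = mult (fun _ => 1) (unweight w) := by
    funext j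
    simp [mult]
  have hdx : dxi (unweight w) = mult symD (unweight w) := rfl
  have hdxx : dxi (mult symD (unweight w)) = mult (fun j => symD j * symD j) (unweight w) := by
    funext j
    simp only [dxi, mult, symD]
    ring
  have hLam : Lam (unweight w) = mult symLam (unweight w) := rfl
  have hLamdx : Lam (mult symD (unweight w)) =
      mult (fun j => symLam j * symD j) (unweight w) := by
    funext j
    simp only [Lam, mult, symLam]
    ring
  have hleib : symLam k * prodD (unweight w) (mult symD (unweight w)) k = symH k *
      (prodD (mult symD (unweight w)) (mult symD (unweight w)) k
        + prodD (unweight w) (mult (fun j => symD j * symD j) (unweight w)) k) := by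
    have h := prodD_dxi (u := unweight w) (v := mult symD (unweight w))
      (h1 ▸ memℓp_mult_unweight norm_one_le w) (memℓp_mult_unweight norm_symD_le w)
      (memℓp_mult_unweight norm_symD_le w)
      (hdxx ▸ memℓp_mult_unweight norm_symD_mul_symD_le w) k
    rw [hdxx, hdx] at h
    rw [← h, ← symH_mul_symD, symD, mul_assoc]
  have hquad : quadPart (unweight w) k =
      2 * prodD (mult symD (unweight w)) (mult symLam (unweight w)) k
      - symH k * (prodD (mult symD (unweight w)) (mult symD (unweight w)) k
        + prodD (unweight w) (mult (fun j => symD j * symD j) (unweight w)) k)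
      + prodD (unweight w) (mult (fun j => symLam j * symD j) (unweight w)) k := by
    rw [← hleib, quadPart, comm, hdx, hLam, hLamdx]
    simp only [Pi.sub_apply, Pi.smul_apply, smul_eq_mul]
    rw [show Lam (prodD (unweight w) (mult symD (unweight w))) k =
      symLam k * prodD (unweight w) (mult symD (unweight w)) k from rfl]
    ring
  have h0 : ∀ {s : ℤ → ℂ}, (∀ k : ℤ, ‖s k‖ ≤ 1 * (1 + (k : ℝ) ^ 2)) →
      prodD (unweight w) (mult s (unweight w)) k = conv (lowWeight (fun _ => 1) norm_one_sq_le) w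
        (diag (fun k => s k / weight k) w) k := fun hs => by
    rw [← prodD_mult_unweight norm_one_sq_le hs, ← h1]
  rw [prodD_mult_unweight norm_symD_sq_le norm_symLam_le,
    prodD_mult_unweight norm_symD_sq_le norm_symD_le, h0 norm_symD_mul_symD_le,
    h0 norm_symLam_mul_symD_le] at hquad
  rw [modelRHS, Pi.sub_apply, Pi.smul_apply, smul_eq_mul, hAB, hAB, hLin, hquad, quadForm_apply,
    diag_apply (norm_neg_symAB_mul_weight_le hΥ hδ)]
  simp only [lp.coeFn_add, lp.coeFn_sub, lp.coeFn_smul, Pi.add_apply, Pi.sub_apply, Pi.smul_apply,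
    smul_eq_mul]
  rw [diag_apply norm_symH_le, lp.coeFn_add, Pi.add_apply, eq_div_iff (weight_ne_zero k), symModel,
    unweight]
  have hw := weight_ne_zero k
  field_simp
  ring

/-! ### Solutions of the equation as curves of weighted Fourier coefficients -/

/-- The isomorphism from `ℓ²(ℤ)` onto `H²(𝕋)` which sends `w` to the function with Fourier
coefficients `w k / (1 + k²)`, seen as a map to `L²(𝕋)`. -/
def ofWeighted : SqSum →L[ℂ] L2T :=
  (fourierBasis (T := 2 * Real.pi)).repr.symm.toContinuousLinearEquiv.toContinuousLinearMap.comp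
    (diag fun k => 1 / weight k)

theorem coef_repr_symm (y : SqSum) :
    coef ((fourierBasis (T := 2 * Real.pi)).repr.symm y) = y := by
  funext k
  rw [coef_apply, LinearIsometryEquiv.apply_symm_apply]

theorem coef_ofWeighted (w : SqSum) : coef (ofWeighted w) = unweight w := by
  refine (coef_repr_symm (diag (fun k => 1 / weight k) w)).trans ?_
  funext k
  rw [diag_apply (norm_div_weight_le norm_one_le), unweight]
  ring

theorem weight_mul_coef_ofWeighted (w : SqSum) (k : ℤ) :
    weight k * coef (ofWeighted w) k = w k := by
  rw [coef_ofWeighted, unweight, mul_div_cancel₀ _ (weight_ne_zero k)]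

theorem ofWeighted_injective : Function.Injective ofWeighted := fun w z h => by
  ext k
  rw [← weight_mul_coef_ofWeighted w, h, weight_mul_coef_ofWeighted]

theorem sobolev_term (f : L2T) (k : ℤ) :
    (1 + (k : ℝ) ^ 2) ^ (2 : ℝ) * ‖coef f k‖ ^ 2 = ‖weight k * coef f k‖ ^ 2 := by
  rw [norm_mul, norm_weight, mul_pow, Real.rpow_two]

theorem hasSum_sobolev (w : SqSum) :
    HasSum (fun k : ℤ => (1 + (k : ℝ) ^ 2) ^ (2 : ℝ) * ‖coef (ofWeighted w) k‖ ^ 2)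
      (‖w‖ ^ 2) := by
  simp only [sobolev_term, weight_mul_coef_ofWeighted]
  exact w.hasSum_sq

theorem memSobolev_ofWeighted (w : SqSum) : MemSobolev 2 (ofWeighted w) :=
  (hasSum_sobolev w).summable

theorem sobolevNorm_ofWeighted (w : SqSum) : sobolevNorm 2 (ofWeighted w) = ‖w‖ := by
  rw [sobolevNorm, (hasSum_sobolev w).tsum_eq, Real.sqrt_sq (norm_nonneg w)]

theorem MemSobolev.exists_ofWeighted {f : L2T} (hf : MemSobolev 2 f) :
    ∃ w, ofWeighted w = f := by
  simp only [MemSobolev, sobolev_term] at hf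
  let w : SqSum := ⟨fun k => weight k * coef f k, memℓp_two_iff.mpr hf⟩
  refine ⟨w, coef_injective ?_⟩
  rw [coef_ofWeighted]
  funext k
  exact mul_div_cancel_left₀ _ (weight_ne_zero k)

theorem continuousInSobolev_ofWeighted {T : ℝ} {w : ℝ → SqSum} :
    ContinuousInSobolev 2 T (fun t => ofWeighted (w t)) ↔ ContinuousOn w (Icc 0 T) := by
  simp only [ContinuousInSobolev, ← map_sub, sobolevNorm_ofWeighted, memSobolev_ofWeighted,
    implies_true, true_and, ContinuousOn, ContinuousWithinAt]
  exact forall₂_congr fun t _ => tendsto_iff_norm_sub_tendsto_zero.symm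

theorem hasDerivWithinAt_coord {w : ℝ → SqSum} {v : SqSum} {s : Set ℝ} {t : ℝ}
    (h : HasDerivWithinAt w v s t) (k : ℤ) : HasDerivWithinAt (fun t => w t k) (v k) s t :=
  ((lp.evalCLM ℂ (fun _ : ℤ => ℂ) 2 k).restrictScalars ℝ).hasFDerivAt.comp_hasDerivWithinAt t h

section Equation

variable {ε Υ δ β : ℝ}

/-- The derivative exists for the unweighted coefficients, in `ℓ²(ℤ)`: the entries
`symModel k / (1 + k²)` are bounded, whereas `symModel` is not. -/
theorem IsModeSolution.isSolution (hε : 0 < ε) (hΥ : 0 < Υ) (hδ : 0 < δ) (hβ : 0 < β) {T : ℝ}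
    {w₀ : SqSum} {w : ℝ → SqSum}
    (hw : IsModeSolution (symModel ε Υ δ β) (quadForm Υ δ) T w₀ w) :
    IsSolution ε Υ δ β T (ofWeighted w₀) fun t => ofWeighted (w t) where
  continuous := continuousInSobolev_ofWeighted.mpr hw.continuousOn
  initial := by rw [hw.initial]
  equation := fun τ hτ => by
    have hlam := norm_div_weight_le (norm_symModel_le hε hΥ hδ hβ)
    have hone := norm_div_weight_le norm_one_le
    let V : ℝ → SqSum := fun t => diag (fun k => symModel ε Υ δ β k / weight k) (w t)
      + diag (fun k => 1 / weight k) (quadForm Υ δ (w t) (w t))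
    have hVk : ∀ t k, V t k =
        (symModel ε Υ δ β k * w t k + quadForm Υ δ (w t) (w t) k) / weight k := fun t k => by
      simp only [V, lp.coeFn_add, Pi.add_apply]
      rw [diag_apply hlam, diag_apply hone]
      ring
    have hV : ContinuousOn V (Icc 0 T) := by
      have hc : Continuous fun z : SqSum => diag (fun k => symModel ε Υ δ β k / weight k) z
        + diag (fun k => 1 / weight k) (quadForm Υ δ z z) := by fun_prop
      exact hc.comp_continuousOn hw.continuousOn
    have hder := hasDerivWithinAt_of_coord (y := fun t => diag (fun k => 1 / weight k) (w t)) hV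
      (fun t ht k => by
        simp only [diag_apply hone, hVk, div_mul_eq_mul_div, one_mul]
        exact (hw.deriv t ht k).div_const _) hτ
    refine ⟨(fourierBasis (T := 2 * Real.pi)).repr.symm (V τ), ?_, ?_⟩
    · rw [coef_repr_symm, coef_ofWeighted]
      funext k
      rw [hVk, modelRHS_unweight hΥ hδ]
    · exact (((fourierBasis (T := 2 * Real.pi)).repr.symm.toContinuousLinearEquiv
        |>.toContinuousLinearMap).restrictScalars ℝ).hasFDerivAt.comp_hasDerivWithinAt τ hder

/-- Fourier coefficients are continuous functionals on `L²(𝕋)`, so every solution solves the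
equation mode by mode. -/
theorem IsSolution.exists_isModeSolution (hΥ : 0 < Υ) (hδ : 0 < δ) {T : ℝ} (hT : 0 ≤ T)
    {w₀ : SqSum} {G : ℝ → L2T} (hG : IsSolution ε Υ δ β T (ofWeighted w₀) G) :
    ∃ w, IsModeSolution (symModel ε Υ δ β) (quadForm Υ δ) T w₀ w ∧
      ∀ t ∈ Icc 0 T, ofWeighted (w t) = G t := by
  choose! w hw using fun t (ht : t ∈ Icc 0 T) => (hG.continuous.1 t ht).exists_ofWeighted
  refine ⟨w, ⟨?_, ?_, fun t ht k => ?_⟩, hw⟩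
  · refine continuousInSobolev_ofWeighted.mp ⟨fun t _ => memSobolev_ofWeighted _, fun t ht => ?_⟩
    refine (hG.continuous.2 t ht).congr' ?_
    filter_upwards [self_mem_nhdsWithin] with s hs
    rw [hw s hs, hw t ht]
  · refine ofWeighted_injective ?_
    rw [hw 0 ⟨le_rfl, hT⟩, hG.initial]
  · obtain ⟨V, hV, hder⟩ := hG.equation t ht
    have h1 := ((fourierBasis (T := 2 * Real.pi)).repr.toContinuousLinearEquiv
      |>.toContinuousLinearMap.restrictScalars ℝ).hasFDerivAt.comp_hasDerivWithinAt t hder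
    have h2 : HasDerivWithinAt (fun s => weight k * coef (G s) k) (weight k * coef V k)
        (Icc 0 T) t := by
      simp only [coef_apply]
      exact (hasDerivWithinAt_coord h1 k).const_mul (weight k)
    rw [hV, ← hw t ht, coef_ofWeighted, modelRHS_unweight hΥ hδ,
      mul_div_cancel₀ _ (weight_ne_zero k)] at h2
    have hk : ∀ s ∈ Icc 0 T, w s k = weight k * coef (G s) k := fun s hs => by
      rw [← hw s hs, weight_mul_coef_ofWeighted]
    exact h2.congr hk (hk t ht)

end Equation

/-! ### Complex conjugation -/

theorem memℓp_reflect (w : SqSum) : Memℓp (fun k => conj (w (-k))) 2 := by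
  rw [memℓp_two_iff]
  simp only [RCLike.norm_conj]
  exact w.hasSum_sq.summable.comp_injective neg_injective

/-- Complex conjugation on the Fourier side, `(w k)ₖ ↦ (conj (w (-k)))ₖ`. -/
def reflect (w : SqSum) : SqSum := ⟨fun k => conj (w (-k)), memℓp_reflect w⟩

theorem reflect_apply (w : SqSum) (k : ℤ) : reflect w k = conj (w (-k)) := rfl

theorem reflect_add (w z : SqSum) : reflect (w + z) = reflect w + reflect z := by
  ext k
  simp [reflect_apply]

theorem reflect_sub (w z : SqSum) : reflect (w - z) = reflect w - reflect z := by
  ext k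
  simp [reflect_apply]

theorem norm_reflect (w : SqSum) : ‖reflect w‖ = ‖w‖ := by
  have h1 := (reflect w).hasSum_sq
  simp only [reflect_apply, RCLike.norm_conj] at h1
  have h2 := (Equiv.neg ℤ).hasSum_iff (f := fun k => ‖w k‖ ^ 2) |>.mpr w.hasSum_sq
  exact (pow_left_inj₀ (norm_nonneg _) (norm_nonneg _) two_ne_zero).mp (h1.unique h2)

theorem continuous_reflect : Continuous reflect :=
  (Isometry.of_dist_eq fun w z => by
    rw [dist_eq_norm, dist_eq_norm, ← reflect_sub, norm_reflect]).continuous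

theorem diag_reflect {ρ : ℤ → ℂ} {C : ℝ} (hρ : ∀ k, ‖ρ k‖ ≤ C) (h : ∀ k, ρ (-k) = conj (ρ k))
    (w : SqSum) : diag ρ (reflect w) = reflect (diag ρ w) := by
  ext k
  rw [diag_apply hρ, reflect_apply, reflect_apply, diag_apply hρ, h, map_mul, RCLike.conj_conj]

theorem conv_reflect {σ : SqSum} (h : ∀ k, σ (-k) = conj (σ k)) (w z : SqSum) :
    conv σ (reflect w) (reflect z) = reflect (conv σ w z) := by
  ext k
  refine (hasSum_conv σ (reflect w) (reflect z) k).unique ?_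
  have h1 := (Complex.conjCLE.toContinuousLinearMap).hasSum (hasSum_conv σ w z (-k))
  have h2 := (Equiv.neg ℤ).hasSum_iff.mpr h1
  refine h2.congr_fun fun j => ?_
  simp only [Function.comp_apply, Equiv.neg_apply, ContinuousLinearEquiv.coe_coe,
    Complex.conjCLE_apply, map_mul, h, RCLike.conj_conj, reflect_apply]
  rw [show -k - -j = -(k - j) by ring]

theorem quadForm_reflect {Υ δ : ℝ} (hΥ : 0 < Υ) (hδ : 0 < δ) (w : SqSum) :
    quadForm Υ δ (reflect w) (reflect w) = reflect (quadForm Υ δ w w) := by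
  have hdiv : ∀ {s : ℤ → ℂ}, (∀ k, s (-k) = conj (s k)) →
      ∀ k, s (-k) / weight (-k) = conj (s k / weight k) := fun hs k => by
    rw [map_div₀, hs, weight_neg, weight, Complex.conj_ofReal]
  have hσ : ∀ {s : ℤ → ℂ} (h1 : ∀ k : ℤ, ‖s k‖ ^ 2 ≤ 1 + (k : ℝ) ^ 2),
      (∀ k, s (-k) = conj (s k)) → ∀ k, lowWeight s h1 (-k) = conj (lowWeight s h1 k) :=
    fun h1 hs k => hdiv hs k
  have h2 : ∀ w : SqSum, reflect ((2 : ℂ) • w) = (2 : ℂ) • reflect w := fun w => by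
    rw [two_smul, two_smul, reflect_add]
  have hsym : ∀ k, -(symAB Υ δ (-k) * weight (-k)) = conj (-(symAB Υ δ k * weight k)) := fun k => by
    rw [map_neg, map_mul, symAB_neg, weight_neg, weight, Complex.conj_ofReal]
  simp only [quadForm_apply]
  rw [diag_reflect (norm_div_weight_le norm_symLam_le) (hdiv symLam_neg),
    diag_reflect (norm_div_weight_le norm_symD_le) (hdiv symD_neg),
    diag_reflect (norm_div_weight_le norm_symD_mul_symD_le)
      (hdiv (s := fun k => symD k * symD k) fun k => by rw [symD_neg, map_mul]),
    diag_reflect (norm_div_weight_le norm_symLam_mul_symD_le)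
      (hdiv (s := fun k => symLam k * symD k) fun k => by rw [symD_neg, symLam_neg, map_mul]),
    conv_reflect (hσ norm_symD_sq_le symD_neg), conv_reflect (hσ norm_symD_sq_le symD_neg),
    conv_reflect (hσ norm_one_sq_le fun _ => (map_one _).symm),
    conv_reflect (hσ norm_one_sq_le fun _ => (map_one _).symm),
    ← reflect_add, diag_reflect norm_symH_le symH_neg, ← h2, ← reflect_sub, ← reflect_add,
    diag_reflect (norm_neg_symAB_mul_weight_le hΥ hδ) hsym]

theorem IsModeSolution.reflect {lam : ℤ → ℂ} {B : SqSum →L[ℂ] SqSum →L[ℂ] SqSum} {T : ℝ}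
    {w₀ : SqSum} {w : ℝ → SqSum} (hlam : ∀ k, lam (-k) = conj (lam k))
    (hB : ∀ w, B (Plate.reflect w) (Plate.reflect w) = Plate.reflect (B w w))
    (hw : IsModeSolution lam B T w₀ w) :
    IsModeSolution lam B T (Plate.reflect w₀) fun t => Plate.reflect (w t) where
  continuousOn := continuous_reflect.comp_continuousOn hw.continuousOn
  initial := by rw [hw.initial]
  deriv := fun t ht k => by
    have h := (Complex.conjCLE.toContinuousLinearMap).hasFDerivAt.comp_hasDerivWithinAt t
      (hw.deriv t ht (-k))
    refine h.congr_deriv ?_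
    rw [hB, reflect_apply, reflect_apply]
    simp [hlam]

theorem coef_star (f : L2T) (k : ℤ) : coef (star f) k = conj (coef f (-k)) := by
  rw [coef, coef, fourierCoeff, fourierCoeff, ← integral_conj]
  refine integral_congr_ae ?_
  filter_upwards [Lp.coeFn_star f] with x hx
  rw [hx, Pi.star_apply, smul_eq_mul, smul_eq_mul, map_mul, neg_neg, fourier_neg]
  rfl

theorem isRealValued_iff_star_eq (f : L2T) : IsRealValued f ↔ star f = f := by
  rw [IsRealValued, Lp.ext_iff]
  have h := Lp.coeFn_star f
  constructor
  · intro hf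
    filter_upwards [h, hf] with x hx hfx
    rw [hx, Pi.star_apply]
    exact Complex.conj_eq_iff_im.mpr hfx
  · intro hf
    filter_upwards [h, hf] with x hx hfx
    rw [hx, Pi.star_apply] at hfx
    exact Complex.conj_eq_iff_im.mp hfx

theorem isRealValued_ofWeighted (w : SqSum) : IsRealValued (ofWeighted w) ↔ reflect w = w := by
  have h : star (ofWeighted w) = ofWeighted (reflect w) := by
    refine coef_injective ?_
    funext k
    rw [coef_star, coef_ofWeighted, coef_ofWeighted, unweight, unweight, reflect_apply, map_div₀,
      weight_neg]
    congr 1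
    exact Complex.conj_ofReal _
  rw [isRealValued_iff_star_eq, h]
  exact ofWeighted_injective.eq_iff

end Plate

end

theorem theorem6p1 (ε Υ δ β : ℝ) (hε : 0 < ε) (hΥ : 0 < Υ) (hδ : 0 < δ) (hβ : 0 < β) :
    ∃ T : ℝ → ℝ, (∀ R : ℝ, 0 < T R) ∧
      ∀ F₀ : Plate.L2T, Plate.MemSobolev 2 F₀ → Plate.mean F₀ = 0 →
        ∃ F : ℝ → Plate.L2T,
          Plate.IsSolution ε Υ δ β (T (Plate.sobolevNorm 2 F₀)) F₀ F ∧
          (∀ G : ℝ → Plate.L2T,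
            Plate.IsSolution ε Υ δ β (T (Plate.sobolevNorm 2 F₀)) F₀ G →
              Set.EqOn G F (Set.Icc 0 (T (Plate.sobolevNorm 2 F₀)))) ∧
          (Plate.IsRealValued F₀ →
            ∀ τ ∈ Set.Icc 0 (T (Plate.sobolevNorm 2 F₀)), Plate.IsRealValued (F τ)) := by
  have hω : 0 ≤ 1 / ε * ((1 + Υ) / δ) := by positivity
  have hlam := Plate.re_symModel_le hε hΥ hδ hβ
  have hpos : ∀ R : ℝ,
      0 < Plate.existenceTime (1 / ε * ((1 + Υ) / δ)) ‖Plate.quadForm Υ δ‖ |R| := fun R =>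
    Plate.existenceTime_pos (norm_nonneg (Plate.quadForm Υ δ)) (abs_nonneg R)
  refine ⟨_, hpos, fun F₀ hF₀ _ => ?_⟩
  obtain ⟨w₀, rfl⟩ := hF₀.exists_ofWeighted
  rw [Plate.sobolevNorm_ofWeighted, abs_norm]
  obtain ⟨w, hw⟩ := Plate.exists_isModeSolution (B := Plate.quadForm Υ δ) hω hlam (le_refl ‖w₀‖)
  refine ⟨_, hw.isSolution hε hΥ hδ hβ, fun G hG t ht => ?_, fun hreal t ht => ?_⟩
  · obtain ⟨z, hz, hzG⟩ := hG.exists_isModeSolution hΥ hδ (ht.1.trans ht.2)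
    rw [← hzG t ht, hz.eqOn hω hlam hw ht]
  · have hr := hw.reflect (Plate.symModel_neg ε Υ δ β) (Plate.quadForm_reflect hΥ hδ)
    rw [(Plate.isRealValued_ofWeighted w₀).mp hreal] at hr
    exact (Plate.isRealValued_ofWeighted (w t)).mpr (hr.eqOn hω hlam hw ht)
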